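/- **Setting.** Let $q$ be a positive integer, $\alpha\in\mathbb R$, $\kappa\in\{0,1,2,\dots\}\cup\{+\infty\}$, and let $(s_j)_{j=0}^\kappa$ be a sequence of complex $q\times q$ matrices. Here and below, indices are (finite) nonnegative integers, even if $\kappa=+\infty$. Write $H_n=(s_{j+k})_{j,k=0}^n$ and $K_n=(s_{j+k+1})_{j,k=0}^n$ for the block Hankel matrices, and $A^\dagger$ for the Moore–Penrose inverse of $A$. *Classes.* For finite $\kappa$, the sequence belongs to $\mathcal K^{\ge}_{q,\kappa,\alpha}$ (resp. $\mathcal K^{>}_{q,\kappa,\alpha}$) if the following matrices are nonnegative Hermitian (resp. positive Hermitian): $H_0$ if $\kappa=0$; $H_n$ and $-\alpha H_{n-1}+K_{n-1}$ if $\kappa=2n$ with $n\ge1$; $H_n$ and $-\alpha H_n+K_n$ if $\kappa=2n+1$ with $n\ge0$. For $\kappa=+\infty$, it belongs to $\mathcal K^{\ge}_{q,\infty,\alpha}$ (resp. $\mathcal K^{>}_{q,\infty,\alpha}$) if $(s_j)_{j=0}^m$ belongs to $\mathcal K^{\ge}_{q,m,\alpha}$ (resp. $\mathcal K^{>}_{q,m,\alpha}$)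 for every integer $m\ge0$. *Schur transforms.* Given a sequence $(t_j)_{j=0}^{\tau}$ of complex $q\times q$ matrices with $\tau\ge1$, let $u_0=t_0$ and $u_j=-\alpha t_{j-1}+t_j$ for $j\ge1$, and let $r_0=u_0^\dagger$ and $r_j=-u_0^\dagger\sum_{l=0}^{j-1}u_{j-l}r_l$ for $j\ge1$. The first $\alpha$-Schur transform of $(t_j)_{j=0}^\tau$ is the sequence $(-t_0\,r_{j+1}\,t_0)_{j=0}^{\tau-1}$. Put $s_j^{[0,\alpha]}=s_j$, and for $1\le k\le\kappa$ let $(s_j^{[k,\alpha]})_{j=0}^{\kappa-k}$ be the first $\alpha$-Schur transform of $(s_j^{[k-1,\alpha]})_{j=0}^{\kappa-(k-1)}$. *Corrections.* For $0\le k\le\kappa$ and $0\le j\le\kappa-k$ let $$P_{j}^{[k]}=s_j^{[k,\alpha]}-s_0^{[k,\alpha]}\bigl(s_0^{[k,\alpha]}\bigr)^\dagger s_j^{[k,\alpha]}\bigl(s_0^{[k,\alpha]}\bigr)^\dagger s_0^{[k,\alpha]},$$ and for $0\le m\le l\le\kappa$ let $Z_{l}^{[m]}=\sum_{k=0}^{m-1}P_{l-k}^{[k]}$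 (so $Z_l^{[0]}=0$). **Proposition.** Suppose that $(s_j)_{j=0}^\kappa\in\mathcal K^{\ge}_{q,\kappa,\alpha}$. Then the following are equivalent: 1. $(s_j)_{j=0}^\kappa\in\mathcal K^{>}_{q,\kappa,\alpha}$. 2. For every $k$ with $0\le k\le\kappa$, the matrix $s_0^{[k,\alpha]}$ is nonsingular. If (1) holds, then $s_0^{[k,\alpha]}$ is positive Hermitian for all $0\le k\le\kappa$; moreover $P_{j}^{[k]}=0$ for all $0\le k\le\kappa$ and $0\le j\le\kappa-k$, and $Z_{l}^{[m]}=0$ for all $0\le m\le l\le\kappa$. -/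

import Mathlib

open scoped ComplexOrder

noncomputable section

namespace StieltjesSchur

open Matrix

/-! ### Moore-Penrose inverse -/

/-- `X` satisfies the four Penrose equations for the complex matrix `A`. -/
structure IsMoorePenrose {p q : ℕ} (A : Matrix (Fin p) (Fin q) ℂ) (X : Matrix (Fin q) (Fin p) ℂ) :
    Prop where
  mul_mul : A * X * A = A
  mul_mul_inv : X * A * X = X
  left_herm : (A * X)ᴴ = A * X
  right_herm : (X * A)ᴴ = X * A

theorem exists_isMoorePenrose {p q : ℕ} (A : Matrix (Fin p) (Fin q) ℂ) :
    ∃ X, IsMoorePenrose A X := by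
  have hB : (Aᴴ * A).IsHermitian := isHermitian_conjTranspose_mul_self A
  -- a Hermitian generalized inverse `C` of `Aᴴ * A` that commutes with it
  obtain ⟨C, hC, h1, h2, h3⟩ : ∃ C : Matrix (Fin q) (Fin q) ℂ, Cᴴ = C ∧
      (Aᴴ * A) * C * (Aᴴ * A) = Aᴴ * A ∧ C * (Aᴴ * A) * C = C ∧
      (Aᴴ * A) * C = C * (Aᴴ * A) := by
    have hs := hB.spectral_theorem
    set U : Matrix (Fin q) (Fin q) ℂ := (hB.eigenvectorUnitary : Matrix (Fin q) (Fin q) ℂ) with hU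
    have hUU : Uᴴ * U = 1 := by
      have := (Matrix.mem_unitaryGroup_iff').1 hB.eigenvectorUnitary.2
      simpa [star_eq_conjTranspose] using this
    set d : Fin q → ℂ := fun i => (hB.eigenvalues i : ℂ) with hd
    have hs2 : Aᴴ * A = U * diagonal d * Uᴴ := by
      conv_lhs => rw [hs]
      simp [Unitary.conjStarAlgAut_apply, hU, hd, star_eq_conjTranspose, Function.comp_def]
    have key : ∀ a b : Fin q → ℂ, (U * diagonal a * Uᴴ) * (U * diagonal b * Uᴴ)
        = U * diagonal (fun i => a i * b i) * Uᴴ := by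
      intro a b
      calc _ = U * diagonal a * (Uᴴ * U) * diagonal b * Uᴴ := by simp only [Matrix.mul_assoc]
        _ = _ := by rw [hUU, Matrix.mul_one, Matrix.mul_assoc U, diagonal_mul_diagonal]
    refine ⟨U * diagonal (fun i => (d i)⁻¹) * Uᴴ, ?_, ?_, ?_, ?_⟩
    · simp only [conjTranspose_mul, conjTranspose_conjTranspose, diagonal_conjTranspose,
        Matrix.mul_assoc]
      congr 3
      ext i
      simp [hd]
    · rw [hs2, key, key]
      congr 3
      ext i
      exact mul_inv_mul_cancel (d i)
    · rw [hs2, key, key]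
      congr 3
      ext i
      simpa using mul_inv_mul_cancel ((d i)⁻¹)
    · rw [hs2, key, key]
      congr 3
      ext i
      exact mul_comm _ _
  have h4 : A * (C * (Aᴴ * A)) = A := by
    have : (A * (C * (Aᴴ * A)) - A)ᴴ * (A * (C * (Aᴴ * A)) - A) = 0 := by
      have e : (A * (C * (Aᴴ * A)) - A)ᴴ = ((Aᴴ * A) * C - 1) * Aᴴ := by
        simp only [conjTranspose_sub, conjTranspose_mul, conjTranspose_conjTranspose, hC,
          Matrix.sub_mul, Matrix.one_mul, Matrix.mul_assoc]
      rw [e, Matrix.mul_assoc, Matrix.mul_sub, ← Matrix.mul_assoc Aᴴ A, ← Matrix.mul_assoc (Aᴴ * A),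
        h1, sub_self, Matrix.mul_zero]
    exact sub_eq_zero.1 (conjTranspose_mul_self_eq_zero.1 this)
  refine ⟨C * Aᴴ, ?_, ?_, ?_, ?_⟩
  · simpa only [Matrix.mul_assoc] using h4
  · have := congrArg (· * Aᴴ) h2
    simpa only [Matrix.mul_assoc] using this
  · simp only [conjTranspose_mul, conjTranspose_conjTranspose, hC, Matrix.mul_assoc]
  · have : (C * (Aᴴ * A))ᴴ = C * (Aᴴ * A) := by
      rw [conjTranspose_mul, hC, hB.eq, h3]
    simpa only [Matrix.mul_assoc] using this

theorem IsMoorePenrose.unique {p q : ℕ} {A : Matrix (Fin p) (Fin q) ℂ}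
    {X Y : Matrix (Fin q) (Fin p) ℂ} (hX : IsMoorePenrose A X) (hY : IsMoorePenrose A Y) :
    X = Y := by
  have hl : A * X = A * Y := by
    calc A * X = (A * Y * A) * X := by rw [hY.mul_mul]
      _ = (A * Y)ᴴ * (A * X)ᴴ := by rw [hY.left_herm, hX.left_herm, Matrix.mul_assoc (A * Y)]
      _ = (A * X * A * Y)ᴴ := by rw [← conjTranspose_mul]; simp only [Matrix.mul_assoc]
      _ = A * Y := by rw [hX.mul_mul, hY.left_herm]
  have hr : X * A = Y * A := by
    calc X * A = X * (A * Y * A) := by rw [hY.mul_mul]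
      _ = (X * A)ᴴ * (Y * A)ᴴ := by rw [hY.right_herm, hX.right_herm]; simp only [Matrix.mul_assoc]
      _ = (Y * (A * X * A))ᴴ := by rw [← conjTranspose_mul]; simp only [Matrix.mul_assoc]
      _ = Y * A := by rw [hX.mul_mul, hY.right_herm]
  calc X = X * A * X := hX.mul_mul_inv.symm
    _ = Y * A * Y := by rw [hr, Matrix.mul_assoc, hl, ← Matrix.mul_assoc]
    _ = Y := hY.mul_mul_inv

/-- The Moore-Penrose inverse of a complex matrix: the unique solution of the Penrose equations. -/
def mpInv {p q : ℕ} (A : Matrix (Fin p) (Fin q) ℂ) : Matrix (Fin q) (Fin p) ℂ :=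
  Classical.choose (exists_isMoorePenrose A)

theorem mpInv_spec {p q : ℕ} (A : Matrix (Fin p) (Fin q) ℂ) : IsMoorePenrose A (mpInv A) :=
  Classical.choose_spec (exists_isMoorePenrose A)

/-! ### Classes of sequences

A finite or infinite sequence `(s_j)_{j=0}^κ` of complex matrices, `κ ∈ ℕ ∪ {∞}`, is given by a
function `s` on `ℕ` together with `κ : ℕ∞`; no definition below looks at `s j` for `j > κ`. -/

/-- The block Hankel matrix `H_n = (s_{j+k})_{j,k=0}^n`. -/
def blockH {q : ℕ} (s : ℕ → Matrix (Fin q) (Fin q) ℂ) (n : ℕ) :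
    Matrix (Fin (n + 1) × Fin q) (Fin (n + 1) × Fin q) ℂ :=
  Matrix.of fun x y => s ((x.1 : ℕ) + (y.1 : ℕ)) x.2 y.2

/-- The block Hankel matrix `K_n = (s_{j+k+1})_{j,k=0}^n`. -/
def blockK {q : ℕ} (s : ℕ → Matrix (Fin q) (Fin q) ℂ) (n : ℕ) :
    Matrix (Fin (n + 1) × Fin q) (Fin (n + 1) × Fin q) ℂ :=
  Matrix.of fun x y => s ((x.1 : ℕ) + (y.1 : ℕ) + 1) x.2 y.2

/-- `(s_j)_{j=0}^m` belongs to `K^≥_{q,m,α}`, `m` finite: for `m = 2n` the matrices `H_n` and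
(if `n ≥ 1`) `-α H_{n-1} + K_{n-1}`, for `m = 2n+1` the matrices `H_n` and `-α H_n + K_n`, are
nonnegative Hermitian. -/
def KNonnegFin {q : ℕ} (α : ℝ) (m : ℕ) (s : ℕ → Matrix (Fin q) (Fin q) ℂ) : Prop :=
  (∀ n : ℕ, m = 2 * n ∨ m = 2 * n + 1 → (blockH s n).PosSemidef) ∧
  (∀ n : ℕ, m = 2 * (n + 1) ∨ m = 2 * n + 1 →
    ((-(α : ℂ)) • blockH s n + blockK s n).PosSemidef)

/-- `(s_j)_{j=0}^m` belongs to `K^>_{q,m,α}`, `m` finite: the same with positive Hermitian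
matrices. -/
def KPosFin {q : ℕ} (α : ℝ) (m : ℕ) (s : ℕ → Matrix (Fin q) (Fin q) ℂ) : Prop :=
  (∀ n : ℕ, m = 2 * n ∨ m = 2 * n + 1 → (blockH s n).PosDef) ∧
  (∀ n : ℕ, m = 2 * (n + 1) ∨ m = 2 * n + 1 →
    ((-(α : ℂ)) • blockH s n + blockK s n).PosDef)

/-- `(s_j)_{j=0}^κ` belongs to `K^≥_{q,κ,α}`; for `κ = ∞` this means that all its finite
sections `(s_j)_{j=0}^m` belong to `K^≥_{q,m,α}`. -/
def KNonneg {q : ℕ} (α : ℝ) (κ : ℕ∞) (s : ℕ → Matrix (Fin q) (Fin q) ℂ) : Prop :=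
  (∀ m : ℕ, κ = (m : ℕ∞) → KNonnegFin α m s) ∧ (κ = ⊤ → ∀ m : ℕ, KNonnegFin α m s)

/-- `(s_j)_{j=0}^κ` belongs to `K^>_{q,κ,α}`; for `κ = ∞` this means that all its finite
sections `(s_j)_{j=0}^m` belong to `K^>_{q,m,α}`. -/
def KPos {q : ℕ} (α : ℝ) (κ : ℕ∞) (s : ℕ → Matrix (Fin q) (Fin q) ℂ) : Prop :=
  (∀ m : ℕ, κ = (m : ℕ∞) → KPosFin α m s) ∧ (κ = ⊤ → ∀ m : ℕ, KPosFin α m s)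

/-! ### The Schur-type algorithm -/

/-- The reciprocal sequence: `r_0 = s_0†`, `r_j = -s_0† ∑_{l=0}^{j-1} s_{j-l} r_l` for `j ≥ 1`. -/
def recip {p q : ℕ} (s : ℕ → Matrix (Fin p) (Fin q) ℂ) : ℕ → Matrix (Fin q) (Fin p) ℂ
  | 0 => mpInv (s 0)
  | j + 1 => -(mpInv (s 0) * ∑ l : Fin (j + 1), s (j + 1 - (l : ℕ)) * recip s (l : ℕ))
  decreasing_by exact l.isLt

/-- The `[+,α]`-transform `-α s_{j-1} + s_j`, where `s_{-1} = 0`. -/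
def plusTransform {p q : ℕ} (α : ℂ) (s : ℕ → Matrix (Fin p) (Fin q) ℂ) :
    ℕ → Matrix (Fin p) (Fin q) ℂ
  | 0 => s 0
  | j + 1 => (-α) • s j + s (j + 1)

/-- The first `α`-Schur transform `(s_j^{[1,α]})_{j=0}^{κ-1}` of `(s_j)_{j=0}^κ`:
`s_j^{[1,α]} = -s_0 r_{j+1} s_0`, where `r` is the reciprocal sequence of the
`[+,α]`-transform. Its `j`-th entry depends on `s_0, …, s_{j+1}` only. -/
def schurTransform {p q : ℕ} (α : ℂ) (s : ℕ → Matrix (Fin p) (Fin q) ℂ) (j : ℕ) :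
    Matrix (Fin p) (Fin q) ℂ :=
  s 0 * (-(recip (plusTransform α s) (j + 1))) * s 0

/-- The `k`-th `α`-Schur transform `(s_j^{[k,α]})_{j=0}^{κ-k}`. -/
def schurIter {p q : ℕ} (α : ℂ) (s : ℕ → Matrix (Fin p) (Fin q) ℂ) :
    ℕ → ℕ → Matrix (Fin p) (Fin q) ℂ
  | 0 => s
  | k + 1 => schurTransform α (schurIter α s k)

/-- `P_j^{[k]} = s_j^{[k,α]} - s_0^{[k,α]} (s_0^{[k,α]})† s_j^{[k,α]} (s_0^{[k,α]})† s_0^{[k,α]}`. -/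
def corrP {p q : ℕ} (α : ℂ) (s : ℕ → Matrix (Fin p) (Fin q) ℂ) (j k : ℕ) :
    Matrix (Fin p) (Fin q) ℂ :=
  schurIter α s k j - schurIter α s k 0 * mpInv (schurIter α s k 0) * schurIter α s k j *
    mpInv (schurIter α s k 0) * schurIter α s k 0

/-- `Z_l^{[m]} = ∑_{k=0}^{m-1} P_{l-k}^{[k]}` (used for `m ≤ l`; it is `0` for `m = 0`). -/
def corrZ {p q : ℕ} (α : ℂ) (s : ℕ → Matrix (Fin p) (Fin q) ℂ) (l m : ℕ) :
    Matrix (Fin p) (Fin q) ℂ :=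
  ∑ k ∈ Finset.range m, corrP α s (l - k) k

end StieltjesSchur

end

/-!
Both classes are described by the block Hankel matrices `H_n` and `-α H_n + K_n`, the latter being
the Hankel matrix of the `[+,α]`-transform shifted by one. If `s_0` is nonsingular, the
`[+,α]`-transform `u` of `s` is, as a power series, a unit, and its inverse `r` has the coefficients
that define the Schur transform `s^{[1]}`. For power series with `G F = 1`, comparing the
coefficients of degree `i + j + 1` shows that the Hankel matrix of the shifted coefficients of `G`
equals that of `-F`, multiplied by the lower triangular Toeplitz matrix of `G` on the left and by
its adjoint on the right. Applied to `G = u` this makes `-α H_n + K_n` of `s` congruent to `H_n` of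
`s^{[1]}`; applied to `G = s`, with the `0`-th row and column split off, it makes `H_{n+1}` of `s`
congruent to the block sum of `s_0` and `-α H_n + K_n` of `s^{[1]}`. Hence a nonnegative sequence
with `s_0` positive Hermitian is positive exactly when its Schur transform is, and the theorem
follows by induction.
-/

noncomputable section

namespace StieltjesSchur

open Matrix PowerSeries
open Finset hiding mk

section Toeplitz

variable {M : Type*} [Ring M] {n : ℕ} {F G : M⟦X⟧}

/-- The `n × n` lower triangular Toeplitz matrix whose first column lists the coefficients
of `F`. -/
def lowerToeplitz (n : ℕ) (F : M⟦X⟧) : Matrix (Fin n) (Fin n) M :=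
  of fun i j => coeff (i : ℕ) (F * X ^ (j : ℕ))

/-- The `n × n` upper triangular Toeplitz matrix whose first row lists the coefficients of `F`. -/
def upperToeplitz (n : ℕ) (F : M⟦X⟧) : Matrix (Fin n) (Fin n) M :=
  of fun i j => coeff (j : ℕ) (X ^ (i : ℕ) * F)

/-- The `n × n` Hankel matrix of a sequence. -/
def hankel {A : Type*} (n : ℕ) (a : ℕ → A) : Matrix (Fin n) (Fin n) A :=
  of fun i j => a ((i : ℕ) + (j : ℕ))

/-- The power series `F` with its first `k` coefficients dropped. -/
def shift (k : ℕ) (F : M⟦X⟧) : M⟦X⟧ :=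
  mk fun j => coeff (j + k) F

theorem sum_fin_ite_le {A : Type*} [AddCommMonoid A] (φ : ℕ → ℕ → A) (i : Fin n) :
    ∑ j : Fin n, (if (j : ℕ) ≤ i then φ (i - j) j else 0) =
      ∑ p ∈ antidiagonal (i : ℕ), φ p.1 p.2 := by
  have hi : (range n).filter (· ≤ (i : ℕ)) = range (i : ℕ).succ := by
    ext
    simp only [mem_filter, mem_range]
    omega
  rw [Fin.sum_univ_eq_sum_range (fun j => if j ≤ (i : ℕ) then φ (i - j) j else 0) n,
    ← sum_filter, hi, ← Nat.sum_antidiagonal_swap]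
  exact (Nat.sum_antidiagonal_eq_sum_range_succ (fun a b => φ b a) i).symm

theorem lowerToeplitz_mul_of_coeff {ι : Type*} (F : M⟦X⟧) (B : ι → M⟦X⟧) :
    lowerToeplitz n F * of (fun (i : Fin n) k => coeff (i : ℕ) (B k)) =
      of fun (i : Fin n) k => coeff (i : ℕ) (F * B k) := by
  ext i k
  simp only [lowerToeplitz, mul_apply, of_apply, coeff_mul_X_pow', ite_mul, zero_mul]
  rw [sum_fin_ite_le (fun a b => coeff a F * coeff b (B k)), coeff_mul]

theorem of_coeff_mul_upperToeplitz {ι : Type*} (B : ι → M⟦X⟧) (F : M⟦X⟧) :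
    of (fun k (j : Fin n) => coeff (j : ℕ) (B k)) * upperToeplitz n F =
      of fun k (j : Fin n) => coeff (j : ℕ) (B k * F) := by
  ext k j
  simp only [upperToeplitz, mul_apply, of_apply, coeff_X_pow_mul', mul_ite, mul_zero]
  rw [sum_fin_ite_le (fun a b => coeff b (B k) * coeff a F), coeff_mul,
    ← Nat.sum_antidiagonal_swap]
  rfl

theorem lowerToeplitz_mul (F G : M⟦X⟧) :
    lowerToeplitz n F * lowerToeplitz n G = lowerToeplitz n (F * G) := by
  simp only [lowerToeplitz, mul_assoc]
  exact lowerToeplitz_mul_of_coeff F fun j : Fin n => G * X ^ (j : ℕ)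

theorem upperToeplitz_mul (F G : M⟦X⟧) :
    upperToeplitz n F * upperToeplitz n G = upperToeplitz n (F * G) := by
  simp only [upperToeplitz, ← mul_assoc]
  exact of_coeff_mul_upperToeplitz (fun i : Fin n => X ^ (i : ℕ) * F) G

theorem lowerToeplitz_one : lowerToeplitz n (1 : M⟦X⟧) = 1 := by
  ext i j
  simp [lowerToeplitz, coeff_X_pow, one_apply, Fin.ext_iff]

theorem upperToeplitz_one : upperToeplitz n (1 : M⟦X⟧) = 1 := by
  ext i j
  simp [upperToeplitz, coeff_X_pow, one_apply, Fin.ext_iff, eq_comm]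

theorem coeff_shift (k j : ℕ) (F : M⟦X⟧) : coeff j (shift k F) = coeff (j + k) F :=
  coeff_mk _ _

theorem shift_zero (F : M⟦X⟧) : shift 0 F = F := by
  ext1 j
  rw [coeff_shift, add_zero]

theorem coeff_mul_add_succ (F G : M⟦X⟧) (i b : ℕ) :
    coeff (i + b + 1) (F * G) =
      coeff i (F * shift (b + 1) G) + coeff b (shift (i + 1) F * G) := by
  simp only [coeff_mul, coeff_shift]
  rw [Nat.sum_antidiagonal_eq_sum_range_succ (fun x y => coeff x F * coeff y G),
    Nat.sum_antidiagonal_eq_sum_range_succ (fun x y => coeff x F * coeff (y + (b + 1)) G),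
    Nat.sum_antidiagonal_eq_sum_range_succ (fun x y => coeff (x + (i + 1)) F * coeff y G),
    show (i + b + 1).succ = i.succ + b.succ by omega, sum_range_add]
  refine congrArg₂ (· + ·) (sum_congr rfl fun x hx => ?_) (sum_congr rfl fun x _ => ?_)
  · rw [show i + b + 1 - x = i - x + (b + 1) by have := mem_range.1 hx; omega]
  · rw [show i.succ + x = x + (i + 1) by omega, show i + b + 1 - (x + (i + 1)) = b - x by omega]

theorem coeff_shift_mul_of_mul_eq_one (h : G * F = 1) (i b : ℕ) :
    coeff b (shift (i + 1) G * F) = -coeff i (G * shift (b + 1) F) := by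
  refine eq_neg_of_add_eq_zero_right ?_
  rw [← coeff_mul_add_succ, h, coeff_one, if_neg (by omega)]

theorem hankel_succ_mul_upperToeplitz (h : G * F = 1) :
    hankel n (fun j => coeff (j + 1) G) * upperToeplitz n F =
      lowerToeplitz n G * hankel n (fun j => -coeff (j + 1) F) := by
  have hG : hankel n (fun j => coeff (j + 1) G) =
      of fun i j : Fin n => coeff (j : ℕ) (shift (i + 1) G) := by
    ext i j
    rw [hankel, of_apply, of_apply, coeff_shift, add_left_comm, ← add_assoc]
  have hF : hankel n (fun j => -coeff (j + 1) F) =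
      of fun i j : Fin n => coeff (i : ℕ) (-shift (j + 1) F) := by
    ext i j
    rw [hankel, of_apply, of_apply, map_neg, coeff_shift, add_assoc]
  rw [hG, hF, of_coeff_mul_upperToeplitz, lowerToeplitz_mul_of_coeff]
  ext i j
  simp only [of_apply, coeff_shift_mul_of_mul_eq_one h, mul_neg, map_neg]

/-- The block diagonal matrix `diag(c, A)`. -/
def consDiag {R : Type*} [Zero R] (c : R) (A : Matrix (Fin n) (Fin n) R) :
    Matrix (Fin (n + 1)) (Fin (n + 1)) R :=
  of (vecCons (vecCons c 0) fun i => vecCons 0 (A i))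

theorem hankel_mul_upperToeplitz (h : G * F = 1) :
    hankel (n + 1) (fun j => coeff j G) * upperToeplitz (n + 1) F =
      lowerToeplitz (n + 1) G *
        consDiag (coeff 0 F) (hankel n fun j => -coeff (j + 2) F) := by
  have hG : hankel (n + 1) (fun j => coeff j G) =
      of fun i j : Fin (n + 1) => coeff (j : ℕ) (shift i G) := by
    ext i j
    rw [hankel, of_apply, of_apply, coeff_shift, add_comm]
  have hF : consDiag (coeff 0 F) (hankel n fun j => -coeff (j + 2) F) =
      of fun i j : Fin (n + 1) => coeff (i : ℕ)
        (vecCons (C (coeff 0 F)) (fun j : Fin n => -(X * shift (j + 2) F)) j) := by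
    ext i j
    cases i using Fin.cases <;> cases j using Fin.cases <;>
      simp [consDiag, hankel, coeff_shift, coeff_succ_X_mul, coeff_succ_C, add_assoc]
  rw [hG, hF, of_coeff_mul_upperToeplitz, lowerToeplitz_mul_of_coeff]
  ext i j
  simp only [of_apply]
  cases j using Fin.cases with
  | zero =>
    rw [Fin.val_zero, cons_val_zero, coeff_mul_C, coeff_mul, Nat.antidiagonal_zero, sum_singleton,
      coeff_shift, zero_add]
  | succ b =>
    rw [cons_val_succ, mul_neg, ← mul_assoc, (commute_X G).eq, mul_assoc, map_neg, Fin.val_succ]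
    cases i using Fin.cases with
    | zero => simp [shift_zero, h, coeff_one]
    | succ a =>
      rw [Fin.val_succ, coeff_succ_X_mul, coeff_shift_mul_of_mul_eq_one h, add_assoc]

theorem conjTranspose_lowerToeplitz [StarRing M] (hG : ∀ j < n, IsSelfAdjoint (coeff j G)) :
    (lowerToeplitz n G)ᴴ = upperToeplitz n G := by
  ext i j
  rw [conjTranspose_apply, lowerToeplitz, upperToeplitz, of_apply, of_apply, coeff_mul_X_pow',
    coeff_X_pow_mul']
  split_ifs
  · exact hG _ (by omega)
  · exact star_zero M

theorem isUnit_lowerToeplitz [IsStablyFiniteRing M] (h : G * F = 1) :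
    IsUnit (lowerToeplitz n G) :=
  .of_mul_eq_one (lowerToeplitz n F) (by rw [lowerToeplitz_mul, h, lowerToeplitz_one])

theorem eq_conj_of_mul_upperToeplitz_eq [StarRing M] [IsStablyFiniteRing M] (h : G * F = 1)
    (hG : ∀ j < n, IsSelfAdjoint (coeff j G)) {A B : Matrix (Fin n) (Fin n) M}
    (hAB : A * upperToeplitz n F = lowerToeplitz n G * B) :
    A = lowerToeplitz n G * B * (lowerToeplitz n G)ᴴ := by
  have hGF : upperToeplitz n G * upperToeplitz n F = 1 := by
    rw [upperToeplitz_mul, h, upperToeplitz_one]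
  rw [conjTranspose_lowerToeplitz hG, ← hAB, Matrix.mul_assoc, mul_eq_one_comm.1 hGF,
    Matrix.mul_one]

end Toeplitz

section SameDefiniteness

/-- `A` and `B`, possibly of different sizes, are simultaneously nonnegative Hermitian and
simultaneously positive Hermitian. -/
structure SameDefiniteness {R m n : Type*} [Ring R] [PartialOrder R] [StarRing R]
    (A : Matrix m m R) (B : Matrix n n R) : Prop where
  posSemidef_iff : A.PosSemidef ↔ B.PosSemidef
  posDef_iff : A.PosDef ↔ B.PosDef

namespace SameDefiniteness

variable {R l m n : Type*} [Ring R] [PartialOrder R] [StarRing R]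
  {A : Matrix l l R} {B : Matrix m m R} {C : Matrix n n R}

theorem symm (h : SameDefiniteness A B) : SameDefiniteness B A :=
  ⟨h.posSemidef_iff.symm, h.posDef_iff.symm⟩

theorem trans (hAB : SameDefiniteness A B) (hBC : SameDefiniteness B C) : SameDefiniteness A C :=
  ⟨hAB.posSemidef_iff.trans hBC.posSemidef_iff, hAB.posDef_iff.trans hBC.posDef_iff⟩

theorem submatrix_equiv (A : Matrix l l R) (e : m ≃ l) :
    SameDefiniteness (A.submatrix e e) A where
  posSemidef_iff := posSemidef_submatrix_equiv e
  posDef_iff := ⟨fun h => by simpa using h.submatrix e.symm.injective,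
    fun h => h.submatrix e.injective⟩

theorem conj [Fintype m] [DecidableEq m] {U : Matrix m m R} (hU : IsUnit U) (B : Matrix m m R) :
    SameDefiniteness (U * B * Uᴴ) B :=
  ⟨hU.posSemidef_star_right_conjugate_iff, hU.posDef_star_right_conjugate_iff⟩

theorem fromBlocks {𝕜 : Type*} [RCLike 𝕜] [Finite l] [Finite m]
    {A : Matrix l l 𝕜} (hA : A.PosDef) (D : Matrix m m 𝕜) :
    SameDefiniteness (Matrix.fromBlocks A 0 0 D) D := by
  classical
  have := Fintype.ofFinite l
  have := Fintype.ofFinite m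
  have := hA.isUnit.invertible
  have hD : (Matrix.fromBlocks A 0 0 D).PosSemidef ↔ D.PosSemidef := by
    simpa using PosDef.fromBlocks₁₁ (0 : Matrix l m 𝕜) D hA
  refine ⟨hD, fun h => h.submatrix (e := Sum.inr) Sum.inr_injective, fun h => ?_⟩
  rw [(hD.2 h.posSemidef).posDef_iff_det_ne_zero, det_fromBlocks_zero₂₁]
  exact mul_ne_zero hA.det_pos.ne' h.det_pos.ne'

end SameDefiniteness

/-- The scalar matrix with blocks `X i j`. -/
abbrev flatten {I J R : Type*} (X : Matrix I I (Matrix J J R)) : Matrix (I × J) (I × J) R :=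
  comp I I J J R X

namespace SameDefiniteness

theorem flatten_conj {I J R : Type*} [Ring R] [PartialOrder R] [StarRing R] [Fintype I]
    [DecidableEq I] [Fintype J] [DecidableEq J] {U : Matrix I I (Matrix J J R)} (hU : IsUnit U)
    (B : Matrix I I (Matrix J J R)) :
    SameDefiniteness (flatten (U * B * Uᴴ)) (flatten B) := by
  have hflat : flatten (U * B * Uᴴ) = flatten U * flatten B * (flatten U)ᴴ := by
    rw [conjTranspose_comp']
    simp only [flatten, ← compRingEquiv_apply, map_mul]
  rw [hflat]
  exact conj (hU.map (compRingEquiv I J R)) _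

theorem flatten_of_mul_upperToeplitz_eq {J R : Type*} [Ring R] [PartialOrder R] [StarRing R]
    [Fintype J] [DecidableEq J] [IsStablyFiniteRing R] {n : ℕ}
    {F G : (Matrix J J R)⟦X⟧} (h : G * F = 1) (hG : ∀ j < n, IsSelfAdjoint (coeff j G))
    {A B : Matrix (Fin n) (Fin n) (Matrix J J R)}
    (hAB : A * upperToeplitz n F = lowerToeplitz n G * B) :
    SameDefiniteness (flatten A) (flatten B) := by
  rw [eq_conj_of_mul_upperToeplitz_eq h hG hAB]
  have hU : IsUnit (lowerToeplitz n G) := isUnit_lowerToeplitz h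
  exact flatten_conj hU B

theorem flatten_conj_const {I J R : Type*} [Ring R] [PartialOrder R] [StarRing R] [Finite I]
    [Fintype J] [DecidableEq J] {c : Matrix J J R} (hc : IsUnit c)
    (B : Matrix I I (Matrix J J R)) :
    SameDefiniteness (flatten (B.map fun b => c * b * cᴴ)) (flatten B) := by
  classical
  have := Fintype.ofFinite I
  have hB : B.map (fun b => c * b * cᴴ) = scalar I c * B * (scalar I c)ᴴ := by
    ext1 i j
    simp [scalar_apply, diagonal_conjTranspose, star_eq_conjTranspose]
  rw [hB]
  exact flatten_conj (hc.map (scalar I)) B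

theorem flatten_consDiag {n : ℕ} {J 𝕜 : Type*} [RCLike 𝕜] [Finite J] {c : Matrix J J 𝕜}
    (hc : c.PosDef) (A : Matrix (Fin n) (Fin n) (Matrix J J 𝕜)) :
    SameDefiniteness (flatten (consDiag c A)) (flatten A) := by
  let e : Fin (n + 1) × J ≃ J ⊕ Fin n × J :=
    ((finSuccEquiv n).prodCongr (.refl J)).trans optionProdEquiv
  have he : flatten (consDiag c A) = (Matrix.fromBlocks c 0 0 (flatten A)).submatrix e e := by
    ext ⟨i, x⟩ ⟨j, y⟩
    cases i using Fin.cases <;> cases j using Fin.cases <;> simp [e, consDiag]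
  rw [he]
  exact (submatrix_equiv _ e).trans (fromBlocks hc _)

end SameDefiniteness

end SameDefiniteness

section SchurStep

variable {q : ℕ} {s : ℕ → Matrix (Fin q) (Fin q) ℂ}

theorem mul_mpInv {A : Matrix (Fin q) (Fin q) ℂ} (hA : IsUnit A) : A * mpInv A = 1 :=
  hA.mul_right_cancel (by rw [(mpInv_spec A).mul_mul, one_mul])

theorem mpInv_mul {A : Matrix (Fin q) (Fin q) ℂ} (hA : IsUnit A) : mpInv A * A = 1 :=
  mul_eq_one_comm.1 (mul_mpInv hA)

theorem mk_mul_mk_recip (h0 : IsUnit (s 0)) : mk s * mk (recip s) = 1 := by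
  ext1 k
  rw [coeff_mul, coeff_one]
  rcases k with _ | j
  · simp [recip, mul_mpInv h0]
  · have hlast : s 0 * recip s (j + 1) = -∑ l ∈ range (j + 1), s (j + 1 - l) * recip s l := by
      rw [recip, mul_neg, ← mul_assoc, mul_mpInv h0, one_mul,
        Fin.sum_univ_eq_sum_range (fun l => s (j + 1 - l) * recip s l) (j + 1)]
    simp only [coeff_mk]
    rw [← Nat.sum_antidiagonal_swap]
    simp only [Prod.fst_swap, Prod.snd_swap]
    rw [Nat.sum_antidiagonal_eq_sum_range_succ (fun l i => s i * recip s l), sum_range_succ,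
      Nat.sub_self, hlast, add_neg_cancel, if_neg j.succ_ne_zero]

theorem mk_plusTransform (α : ℂ) (s : ℕ → Matrix (Fin q) (Fin q) ℂ) :
    mk (plusTransform α s) = (1 - α • X) * mk s := by
  rw [sub_mul, one_mul, smul_mul_assoc]
  ext1 k
  rcases k with _ | k
  · simp [plusTransform]
  · simp [plusTransform, coeff_succ_X_mul, sub_eq_neg_add]

theorem mk_mul_mk_plusTransform_recip (α : ℂ) (h0 : IsUnit (s 0)) :
    mk s * mk (plusTransform α (recip (plusTransform α s))) = 1 := by
  have hcomm : mk s * (1 - α • X) = (1 - α • X) * mk s := by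
    rw [mul_sub, sub_mul, mul_one, one_mul, mul_smul_comm, smul_mul_assoc, (commute_X _).eq]
  rw [mk_plusTransform, ← mul_assoc, hcomm, ← mk_plusTransform,
    mk_mul_mk_recip (s := plusTransform α s) h0]

theorem isSelfAdjoint_plusTransform {α : ℝ} {n : ℕ} (hs : ∀ j < n, IsSelfAdjoint (s j)) :
    ∀ j < n, IsSelfAdjoint (plusTransform (α : ℂ) s j) := by
  rintro (_ | j) hj
  · exact hs 0 hj
  · have hα : IsSelfAdjoint (-(α : ℂ)) := IsSelfAdjoint.neg (Complex.conj_ofReal α)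
    exact (hα.smul (hs j (by omega))).add (hs (j + 1) hj)

theorem blockH_eq_flatten (s : ℕ → Matrix (Fin q) (Fin q) ℂ) (n : ℕ) :
    blockH s n = flatten (hankel (n + 1) s) := rfl

theorem neg_smul_blockH_add_blockK_eq_flatten (α : ℂ) (s : ℕ → Matrix (Fin q) (Fin q) ℂ) (n : ℕ) :
    (-α) • blockH s n + blockK s n =
      flatten (hankel (n + 1) fun j => plusTransform α s (j + 1)) := rfl

theorem sameDefiniteness_blockK_blockH_schurTransform {α : ℝ} {n : ℕ} (h0 : IsUnit (s 0))
    (hs : ∀ j ≤ n, IsSelfAdjoint (s j)) :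
    SameDefiniteness ((-(α : ℂ)) • blockH s n + blockK s n)
      (blockH (schurTransform (α : ℂ) s) n) := by
  set u := plusTransform (α : ℂ) s
  have hur : mk u * mk (recip u) = 1 := mk_mul_mk_recip h0
  have hu : ∀ j < n + 1, IsSelfAdjoint (coeff j (mk u)) := by
    simpa only [coeff_mk] using isSelfAdjoint_plusTransform fun j hj => hs j (Nat.lt_succ_iff.1 hj)
  have htoeplitz : SameDefiniteness (flatten (hankel (n + 1) fun j => u (j + 1)))
      (flatten (hankel (n + 1) fun j => -recip u (j + 1))) := by
    simpa only [coeff_mk] using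
      SameDefiniteness.flatten_of_mul_upperToeplitz_eq hur hu (hankel_succ_mul_upperToeplitz hur)
  have hscale : hankel (n + 1) (schurTransform (α : ℂ) s) =
      (hankel (n + 1) fun j => -recip u (j + 1)).map fun b => s 0 * b * (s 0)ᴴ := by
    ext1 i j
    rw [← star_eq_conjTranspose, (hs 0 n.zero_le).star_eq]
    rfl
  rw [neg_smul_blockH_add_blockK_eq_flatten, blockH_eq_flatten, hscale]
  exact htoeplitz.trans (SameDefiniteness.flatten_conj_const h0 _).symm

theorem sameDefiniteness_blockH_blockK_schurTransform {α : ℝ} {n : ℕ} (h0 : (s 0).PosDef)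
    (hs : ∀ j ≤ n + 1, IsSelfAdjoint (s j)) :
    SameDefiniteness (blockH s (n + 1))
      ((-(α : ℂ)) • blockH (schurTransform (α : ℂ) s) n +
        blockK (schurTransform (α : ℂ) s) n) := by
  set w := plusTransform (α : ℂ) (recip (plusTransform (α : ℂ) s))
  have hsw : mk s * mk w = 1 := mk_mul_mk_plusTransform_recip α h0.isUnit
  have hs' : ∀ j < n + 2, IsSelfAdjoint (coeff j (mk s)) := fun j hj => by
    simpa only [coeff_mk] using hs j (Nat.lt_succ_iff.1 hj)
  have htoeplitz : SameDefiniteness (flatten (hankel (n + 2) s))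
      (flatten (consDiag (w 0) (hankel (n + 1) fun j => -w (j + 2)))) := by
    simpa only [coeff_mk] using
      SameDefiniteness.flatten_of_mul_upperToeplitz_eq hsw hs' (hankel_mul_upperToeplitz hsw)
  have hw0 : s 0 * w 0 = 1 := by simpa using congrArg (coeff 0) hsw
  have hw (j : ℕ) : s 0 * -w (j + 2) * s 0 =
      plusTransform (α : ℂ) (schurTransform (α : ℂ) s) (j + 1) := by
    simp only [w, plusTransform, schurTransform, mul_neg, neg_mul, neg_smul, smul_neg, mul_add,
      add_mul, mul_smul_comm, smul_mul_assoc, neg_add]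
  have hscale : consDiag (s 0)
        (hankel (n + 1) fun j => plusTransform (α : ℂ) (schurTransform (α : ℂ) s) (j + 1)) =
      (consDiag (w 0) (hankel (n + 1) fun j => -w (j + 2))).map
        fun b => s 0 * b * (s 0)ᴴ := by
    ext1 i j
    rw [h0.isHermitian.eq]
    cases i using Fin.cases <;> cases j using Fin.cases <;> simp [consDiag, hankel, hw0, ← hw]
  rw [neg_smul_blockH_add_blockK_eq_flatten, blockH_eq_flatten]
  refine htoeplitz.trans (.trans (.symm ?_) (SameDefiniteness.flatten_consDiag h0 _))
  rw [hscale]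
  exact SameDefiniteness.flatten_conj_const h0.isUnit _

end SchurStep

section Classes

variable {q : ℕ} {α : ℝ} {s : ℕ → Matrix (Fin q) (Fin q) ℂ} {m n : ℕ}

theorem isSelfAdjoint_of_isHermitian_blockH (h : (blockH s n).IsHermitian) :
    ∀ j ≤ 2 * n, IsSelfAdjoint (s j) := by
  intro j hj
  ext x y
  have hxy := h.apply (⟨j / 2, by omega⟩, x) (⟨j - j / 2, by omega⟩, y)
  rw [blockH, of_apply, of_apply] at hxy
  rwa [show j / 2 + (j - j / 2) = j by omega, show j - j / 2 + j / 2 = j by omega] at hxy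

theorem posDef_blockH_zero (h0 : (s 0).PosDef) : (blockH s 0).PosDef := by
  have hH : blockH s 0 = (s 0).submatrix Prod.snd Prod.snd := by
    ext
    simp [blockH]
  rw [hH]
  exact h0.submatrix (Equiv.uniqueProd (Fin q) (Fin 1)).injective

theorem KNonnegFin.isSelfAdjoint (h : KNonnegFin α m s) (hn : m = 2 * n ∨ m = 2 * n + 1) :
    ∀ j ≤ 2 * n, IsSelfAdjoint (s j) :=
  isSelfAdjoint_of_isHermitian_blockH (h.1 n hn).isHermitian

theorem KNonnegFin.posSemidef_zero (h : KNonnegFin α m s) : (s 0).PosSemidef :=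
  (h.1 (m / 2) (by omega)).submatrix fun x => (0, x)

theorem KPosFin.posDef_zero (h : KPosFin α m s) : (s 0).PosDef :=
  (h.1 (m / 2) (by omega)).submatrix (Prod.mk_right_injective 0)

theorem KPosFin.kNonnegFin (h : KPosFin α m s) : KNonnegFin α m s :=
  ⟨fun n hn => (h.1 n hn).posSemidef, fun n hn => (h.2 n hn).posSemidef⟩

theorem KNonnegFin.sameDefiniteness_blockK_blockH (h : KNonnegFin α (m + 1) s)
    (h0 : (s 0).PosDef) (hn : m = 2 * n ∨ m = 2 * n + 1) :
    SameDefiniteness ((-(α : ℂ)) • blockH s n + blockK s n)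
      (blockH (StieltjesSchur.schurTransform (α : ℂ) s) n) :=
  sameDefiniteness_blockK_blockH_schurTransform h0.isUnit fun j hj =>
    h.isSelfAdjoint (n := (m + 1) / 2) (by omega) j (by omega)

theorem KNonnegFin.sameDefiniteness_blockH_blockK (h : KNonnegFin α (m + 1) s)
    (h0 : (s 0).PosDef) (hn : m = 2 * (n + 1) ∨ m = 2 * n + 1) :
    SameDefiniteness (blockH s (n + 1))
      ((-(α : ℂ)) • blockH (StieltjesSchur.schurTransform (α : ℂ) s) n +
        blockK (StieltjesSchur.schurTransform (α : ℂ) s) n) :=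
  sameDefiniteness_blockH_blockK_schurTransform h0 fun j hj =>
    h.isSelfAdjoint (n := n + 1) (by omega) j (by omega)

theorem KNonnegFin.schurTransform (h : KNonnegFin α (m + 1) s) (h0 : (s 0).PosDef) :
    KNonnegFin α m (schurTransform (α : ℂ) s) :=
  ⟨fun n hn => (h.sameDefiniteness_blockK_blockH h0 hn).posSemidef_iff.1 (h.2 n (by omega)),
    fun n hn => (h.sameDefiniteness_blockH_blockK h0 hn).posSemidef_iff.1
      (h.1 (n + 1) (by omega))⟩

theorem KNonnegFin.kPosFin_schurTransform_iff (h : KNonnegFin α (m + 1) s)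
    (h0 : (s 0).PosDef) :
    KPosFin α m (StieltjesSchur.schurTransform (α : ℂ) s) ↔ KPosFin α (m + 1) s := by
  refine ⟨fun ht => ⟨fun n hn => ?_, fun n hn => ?_⟩, fun hp => ⟨fun n hn => ?_, fun n hn => ?_⟩⟩
  · rcases n with _ | n
    · exact posDef_blockH_zero h0
    · exact (h.sameDefiniteness_blockH_blockK h0 (by omega)).posDef_iff.2 (ht.2 n (by omega))
  · exact (h.sameDefiniteness_blockK_blockH h0 (by omega)).posDef_iff.2 (ht.1 n (by omega))
  · exact (h.sameDefiniteness_blockK_blockH h0 hn).posDef_iff.1 (hp.2 n (by omega))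
  · exact (h.sameDefiniteness_blockH_blockK h0 hn).posDef_iff.1 (hp.1 (n + 1) (by omega))

theorem schurIter_schurTransform (α : ℂ) (s : ℕ → Matrix (Fin q) (Fin q) ℂ) (k : ℕ) :
    schurIter α (schurTransform α s) k = schurIter α s (k + 1) := by
  induction k with
  | zero => rfl
  | succ k ih => rw [schurIter, ih, ← schurIter]

theorem KPosFin.posDef_schurIter (h : KPosFin α m s) {k : ℕ} (hk : k ≤ m) :
    (schurIter (α : ℂ) s k 0).PosDef := by
  induction m generalizing s k with
  | zero =>
    obtain rfl := Nat.le_zero.1 hk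
    exact h.posDef_zero
  | succ m ih =>
    rcases k with _ | k
    · exact h.posDef_zero
    · rw [← schurIter_schurTransform]
      exact ih ((h.kNonnegFin.kPosFin_schurTransform_iff h.posDef_zero).2 h) (by omega)

theorem KNonnegFin.kPosFin_of_det_ne_zero (h : KNonnegFin α m s)
    (hdet : ∀ k ≤ m, (schurIter (α : ℂ) s k 0).det ≠ 0) : KPosFin α m s := by
  have h0 : (s 0).PosDef := h.posSemidef_zero.posDef_iff_det_ne_zero.2 (hdet 0 m.zero_le)
  induction m generalizing s with
  | zero =>
    refine ⟨fun n hn => ?_, fun n hn => by omega⟩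
    obtain rfl : n = 0 := by omega
    exact posDef_blockH_zero h0
  | succ m ih =>
    have hdet' (k : ℕ) (hk : k ≤ m) :
        (schurIter (α : ℂ) (StieltjesSchur.schurTransform (α : ℂ) s) k 0).det ≠ 0 := by
      rw [schurIter_schurTransform]
      exact hdet (k + 1) (by omega)
    have ht := h.schurTransform h0
    exact (h.kPosFin_schurTransform_iff h0).1 (ih ht hdet'
      (ht.posSemidef_zero.posDef_iff_det_ne_zero.2 (hdet' 0 m.zero_le)))

theorem KPos.posDef_schurIter {κ : ℕ∞} (h : KPos α κ s) {k : ℕ} (hk : (k : ℕ∞) ≤ κ) :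
    (schurIter (α : ℂ) s k 0).PosDef := by
  induction κ using ENat.recTopCoe with
  | top => exact (h.2 rfl k).posDef_schurIter le_rfl
  | coe m => exact (h.1 m rfl).posDef_schurIter (by exact_mod_cast hk)

theorem KNonneg.kPos_of_det_ne_zero {κ : ℕ∞} (h : KNonneg α κ s)
    (hdet : ∀ k : ℕ, (k : ℕ∞) ≤ κ → (schurIter (α : ℂ) s k 0).det ≠ 0) : KPos α κ s := by
  refine ⟨fun m hm => (h.1 m hm).kPosFin_of_det_ne_zero fun k hk => hdet k ?_,
    fun hκ m => (h.2 hκ m).kPosFin_of_det_ne_zero fun k _ => hdet k (hκ ▸ le_top)⟩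
  rw [hm]
  exact_mod_cast hk

theorem corrP_eq_zero {α : ℂ} {k : ℕ} (h : IsUnit (schurIter α s k 0)) (j : ℕ) :
    corrP α s j k = 0 := by
  rw [corrP, mul_mpInv h, one_mul, mul_assoc, mpInv_mul h, mul_one, sub_self]

theorem KPos.corrP_eq_zero {κ : ℕ∞} (h : KPos α κ s) {k : ℕ} (hk : (k : ℕ∞) ≤ κ) (j : ℕ) :
    corrP (α : ℂ) s j k = 0 :=
  StieltjesSchur.corrP_eq_zero (h.posDef_schurIter hk).isUnit j

theorem KPos.corrZ_eq_zero {κ : ℕ∞} (h : KPos α κ s) {m l : ℕ} (hm : (m : ℕ∞) ≤ κ) :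
    corrZ (α : ℂ) s l m = 0 :=
  Finset.sum_eq_zero fun _ hk =>
    h.corrP_eq_zero (le_trans (by exact_mod_cast (mem_range.1 hk).le) hm) _

end Classes

end StieltjesSchur

end

theorem propositionP1626 (q : ℕ) (α : ℝ) (κ : ℕ∞) (s : ℕ → Matrix (Fin q) (Fin q) ℂ)
    (hs : StieltjesSchur.KNonneg α κ s) :
    (StieltjesSchur.KPos α κ s ↔
      ∀ k : ℕ, (k : ℕ∞) ≤ κ → (StieltjesSchur.schurIter (α : ℂ) s k 0).det ≠ 0) ∧
    (StieltjesSchur.KPos α κ s →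
      (∀ k : ℕ, (k : ℕ∞) ≤ κ → (StieltjesSchur.schurIter (α : ℂ) s k 0).PosDef) ∧
      (∀ k j : ℕ, ((k + j : ℕ) : ℕ∞) ≤ κ → StieltjesSchur.corrP (α : ℂ) s j k = 0) ∧
      (∀ m l : ℕ, m ≤ l → (l : ℕ∞) ≤ κ → StieltjesSchur.corrZ (α : ℂ) s l m = 0)) := by
  refine ⟨⟨fun h k hk => (h.posDef_schurIter hk).det_pos.ne', hs.kPos_of_det_ne_zero⟩,
    fun h => ⟨fun k hk => h.posDef_schurIter hk, fun k j hkj => h.corrP_eq_zero ?_ j,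
      fun m l hml hl => h.corrZ_eq_zero ?_⟩⟩
  · exact le_trans (by exact_mod_cast Nat.le_add_right k j) hkj
  · exact le_trans (by exact_mod_cast hml) hl
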